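/- Let $\mathbb G$ be a Carnot group of step $\kappa\ge 1$, i.e. a nilpotent, connected and simply connected real Lie group whose Lie algebra $\mathfrak g$ of left invariant vector fields has a stratification $\mathfrak g=V_1\oplus\dots\oplus V_\kappa$ with $[V_1,V_i]=V_{i+1}$ for all $i\ge 1$, $V_\kappa\ne\{0\}$ and $V_i=\{0\}$ for $i>\kappa$, where $[V_1,V_i]$ is the span of the commutators $[X,Y]$ with $X\in V_1$, $Y\in V_i$. Fix a Haar measure $\mu$ on $\mathbb G$, and an inner product on $V_1$, given by a basis $(X_1,\dots,X_m)$ of $V_1$ that is declared orthonormal. For a $\mu$-measurable set $E\subset\mathbb G$ and $X\in\mathfrak g$, let $X\mathbb 1_E$ be the distribution $\varphi\mapsto-\int_E X\varphi\,d\mu$, $\varphi\in C_c^\infty(\mathbb G)$. The set $E$ has locally finite $\mathbb G$-perimeter if $X\mathbb 1_E$ is a (signed) Radon measure for every $X\in V_1$. In that case the perimeter measure $|\partial E|_{\mathbb G}$ is the total variation of the $\mathbb R^m$-valued Radon measure $(X_1\mathbb 1_E,\dots,X_m\mathbb 1_E)$, and the intrinsic normal of $E$ is the horizontal section $\nu_E=\sum_i(\nu_E)_iX_i$,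 defined and of length one $|\partial E|_{\mathbb G}$-almost everywhere, such that $X_i\mathbb 1_E=(\nu_E)_i\,|\partial E|_{\mathbb G}$ for $i=1,\dots,m$. We say that $E$ has a constant intrinsic normal if $E$ has locally finite $\mathbb G$-perimeter, $|\partial E|_{\mathbb G}\neq0$, and $\nu_E$ coincides $|\partial E|_{\mathbb G}$-almost everywhere with a fixed element of $V_1$. A vertical halfspace is a set $H\subset\mathbb G$ with a constant intrinsic normal such that $Y\mathbb 1_H=0$ for every $Y\in V_2\oplus\dots\oplus V_\kappa$. Suppose that $\mathbb G$ is of type $\star$, i.e. there is a basis $(Z_1,\dots,Z_m)$ of $V_1$ (in general not related to $(X_1,\dots,X_m)$) with $$[Z_j,[Z_j,Z_i]]=0\qquad\text{for all } i,j=1,\dots,m.$$ Then every set $E\subset\mathbb G$ with a constant intrinsic normal is a vertical halfspace. -/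

import Mathlib

open scoped Manifold ContDiff ENNReal
open MeasureTheory

noncomputable section

namespace Carnot

variable {n : ℕ} {G : Type*} [TopologicalSpace G] [ChartedSpace (EuclideanSpace ℝ (Fin n)) G]
  [Group G]

/-- `V 1, …, V κ` is a step `κ` stratification of the Lie algebra of `G`
(the value `V 0` plays no role). -/
structure IsStratification (κ : ℕ) (V : ℕ → Submodule ℝ (GroupLieAlgebra (𝓡 n) G)) : Prop where
  one_le : 1 ≤ κ
  isInternal : DirectSum.IsInternal fun i : Set.Icc 1 κ => V i
  bracket_eq : ∀ i, 1 ≤ i →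
    Submodule.span ℝ {Z | ∃ X ∈ V 1, ∃ Y ∈ V i, ⁅X, Y⁆ = Z} = V (i + 1)
  top_ne_bot : V κ ≠ ⊥
  eq_bot : ∀ i, κ < i → V i = ⊥

/-- A Lie group `G` is a Carnot group of step `κ` with layers `V 1, …, V κ`: it is nilpotent,
connected and simply connected, and the `V i` stratify its Lie algebra. -/
structure IsCarnotGroup (κ : ℕ) (V : ℕ → Submodule ℝ (GroupLieAlgebra (𝓡 n) G)) : Prop where
  isNilpotent : Group.IsNilpotent G
  simplyConnected : SimplyConnectedSpace G
  isStratification : IsStratification κ V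

/-- Type `⋆`: some basis `X` of the first layer satisfies `[X_j, [X_j, X_i]] = 0`. -/
def IsTypeStar (V : ℕ → Submodule ℝ (GroupLieAlgebra (𝓡 n) G)) : Prop :=
  ∃ (m : ℕ) (X : Module.Basis (Fin m) ℝ (V 1)), ∀ i j,
    ⁅(X j : GroupLieAlgebra (𝓡 n) G), ⁅(X j : GroupLieAlgebra (𝓡 n) G),
      (X i : GroupLieAlgebra (𝓡 n) G)⁆⁆ = 0

/-- The derivative of `φ` along the left invariant vector field that extends `X`. -/
def lieDeriv (X : GroupLieAlgebra (𝓡 n) G) (φ : G → ℝ) (x : G) : ℝ :=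
  mfderiv (𝓡 n) 𝓘(ℝ, ℝ) φ x (mulInvariantVectorField X x)

variable (n) in
/-- Smooth compactly supported real functions on `G`. -/
def IsTestFunction (φ : G → ℝ) : Prop :=
  ContMDiff (𝓡 n) 𝓘(ℝ, ℝ) ∞ φ ∧ HasCompactSupport φ

variable [MeasurableSpace G]

/-- The distribution `X 𝟙_E`, evaluated at a test function `φ`. -/
def indicatorDeriv (μ : Measure G) (E : Set G) (X : GroupLieAlgebra (𝓡 n) G) (φ : G → ℝ) : ℝ :=
  -∫ x in E, lieDeriv X φ x ∂μ

/-- `X 𝟙_E = 0` as a distribution. -/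
def IndicatorDerivEqZero (μ : Measure G) (E : Set G) (X : GroupLieAlgebra (𝓡 n) G) : Prop :=
  ∀ φ : G → ℝ, IsTestFunction n φ → indicatorDeriv μ E X φ = 0

/-- The distribution `X 𝟙_E` is a (signed) Radon measure, that is, a difference of two locally
finite Borel measures, neither of which has to be finite. -/
def IndicatorDerivIsRadon (μ : Measure G) (E : Set G) (X : GroupLieAlgebra (𝓡 n) G) : Prop :=
  ∃ P N : Measure G, IsLocallyFiniteMeasure P ∧ IsLocallyFiniteMeasure N ∧
    ∀ φ : G → ℝ, IsTestFunction n φ →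
      indicatorDeriv μ E X φ = ∫ x, φ x ∂P - ∫ x, φ x ∂N

/-- `E` is measurable and has locally finite `G`-perimeter. -/
def HasLocallyFinitePerimeter (μ : Measure G)
    (V : ℕ → Submodule ℝ (GroupLieAlgebra (𝓡 n) G)) (E : Set G) : Prop :=
  NullMeasurableSet E μ ∧ ∀ X ∈ V 1, IndicatorDerivIsRadon μ E X

/-- The total variation on the open set `U` of the horizontal gradient
`(X_1 𝟙_E, …, X_m 𝟙_E)`. -/
def horizontalVariation {m : ℕ} (μ : Measure G) (X : Fin m → GroupLieAlgebra (𝓡 n) G)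
    (E U : Set G) : ℝ≥0∞ :=
  ⨆ (φ : Fin m → G → ℝ) (_ : (∀ i, IsTestFunction n (φ i) ∧ tsupport (φ i) ⊆ U) ∧
      ∀ x, ∑ i, φ i x ^ 2 ≤ 1),
    ENNReal.ofReal (∑ i, indicatorDeriv μ E (X i) (φ i))

/-- `P` is the perimeter measure of `E`: the locally finite Borel measure
`|(X_1 𝟙_E, …, X_m 𝟙_E)|`. -/
def IsPerimeterMeasure {m : ℕ} (μ : Measure G) (X : Fin m → GroupLieAlgebra (𝓡 n) G)
    (E : Set G) (P : Measure G) : Prop :=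
  IsLocallyFiniteMeasure P ∧ ∀ U : Set G, IsOpen U → P U = horizontalVariation μ X E U

/-- `ν = ∑ i, ν_i X_i` is the generalized intrinsic normal of `E`, whose perimeter measure is
`P`: a measurable horizontal section, of length one `P`-almost everywhere, with
`X_i 𝟙_E = ν_i P` for all `i`. The section is given by its coordinates in the frame `X`, which is
orthonormal. -/
def IsIntrinsicNormal {m : ℕ} (μ : Measure G) (X : Fin m → GroupLieAlgebra (𝓡 n) G)
    (E : Set G) (P : Measure G) (ν : G → EuclideanSpace ℝ (Fin m)) : Prop :=
  AEMeasurable ν P ∧ (∀ᵐ x ∂P, ‖ν x‖ = 1) ∧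
    ∀ i, ∀ φ : G → ℝ, IsTestFunction n φ →
      indicatorDeriv μ E (X i) φ = ∫ x, φ x * ν x i ∂P

/-- `E` is a set of locally finite perimeter, its perimeter is not null, and its intrinsic normal
is constant. The basis `X` of the first layer fixes the inner product of that layer. -/
def HasConstantIntrinsicNormal {m : ℕ} (μ : Measure G)
    (V : ℕ → Submodule ℝ (GroupLieAlgebra (𝓡 n) G)) (X : Module.Basis (Fin m) ℝ (V 1))
    (E : Set G) : Prop :=
  HasLocallyFinitePerimeter μ V E ∧
    ∃ (P : Measure G) (ν : G → EuclideanSpace ℝ (Fin m)),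
      IsPerimeterMeasure μ (fun i => (X i : GroupLieAlgebra (𝓡 n) G)) E P ∧ P ≠ 0 ∧
      IsIntrinsicNormal μ (fun i => (X i : GroupLieAlgebra (𝓡 n) G)) E P ν ∧
      ∃ v : EuclideanSpace ℝ (Fin m), ∀ᵐ x ∂P, ν x = v

/-- A vertical halfspace: a set with constant intrinsic normal whose indicator is annihilated by
`V 2 ⊕ … ⊕ V κ`. -/
def IsVerticalHalfspace {m : ℕ} (μ : Measure G) (κ : ℕ)
    (V : ℕ → Submodule ℝ (GroupLieAlgebra (𝓡 n) G)) (X : Module.Basis (Fin m) ℝ (V 1))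
    (E : Set G) : Prop :=
  HasConstantIntrinsicNormal μ V X E ∧
    ∀ Y ∈ ⨆ i ∈ Set.Icc 2 κ, V i, IndicatorDerivEqZero μ E Y

end Carnot

end

/-!
Let `E` have constant intrinsic normal and perimeter `P`. Then `Y 𝟙_E = l(Y) P` for all `Y` in the
first layer, with `l ≠ 0` linear and `P` a positive measure. Take a basis `Z` as in type `⋆`, an
index `k` with `l(Z_k) ≠ 0`, and set `W_i = Z_i - (l(Z_i) / l(Z_k)) Z_k`, so that `W_i 𝟙_E = 0`.

By type `⋆`, `[Z_k, W_i]` commutes with `W_i`, hence the second derivative of `P` along `W_i`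
vanishes. So for a test function `φ ≥ 0` the function `s ↦ ∫ φ(x exp(s W_i)) dP(x)` is affine and
nonnegative on `ℝ`, therefore constant; thus `W_i P = 0`, that is, `[Z_k, W_i] 𝟙_E = 0`.

The left invariant fields annihilating `𝟙_E` form a Lie algebra. It contains the Lie algebra
generated by the `W_i` and the `[Z_k, W_i]`, which `Z_k` normalizes because
`[Z_k, [Z_k, W_i]] = 0`. Together with `Z_k` this algebra spans the first layer, so it contains
all brackets of elements of the first layer and, inductively, all higher layers.
-/

open scoped Topology Pointwise

section VectorField

open VectorField Set

variable {𝕜 : Type*} [NontriviallyNormedField 𝕜]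
  {E : Type*} [NormedAddCommGroup E] [NormedSpace 𝕜 E] {H : Type*} [TopologicalSpace H]
  {I : ModelWithCorners 𝕜 E H} {M : Type*} [TopologicalSpace M] [ChartedSpace H M]
  {F : Type*} [NormedAddCommGroup F] [NormedSpace 𝕜 F]
  {V W : Π x : M, TangentSpace I x} {g : M → F} {x : M}

theorem fderivWithin_comp_extChartAt_symm_apply_mpullbackWithin [IsManifold I 1 M]
    {y : E} (hy : y ∈ (extChartAt I x).target)
    (hg : MDifferentiableAt I 𝓘(𝕜, F) g ((extChartAt I x).symm y)) :
    fderivWithin 𝕜 (g ∘ (extChartAt I x).symm) (range I) y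
        (mpullbackWithin 𝓘(𝕜, E) I (extChartAt I x).symm V (range I) y) =
      mvfderiv I g ((extChartAt I x).symm y) (V ((extChartAt I x).symm y)) := by
  have hu : UniqueMDiffWithinAt 𝓘(𝕜, E) (range I) y :=
    I.uniqueMDiffOn y (extChartAt_target_subset_range x hy)
  have hd := mdifferentiableWithinAt_extChartAt_symm (I := I) hy
  have hinv := isInvertible_mfderivWithin_extChartAt_symm (I := I) hy
  rw [← mfderivWithin_eq_fderivWithin, mfderiv_comp_mfderivWithin y hg hd hu, mpullbackWithin_apply]
  exact congrArg (mfderiv I 𝓘(𝕜, F) g _) (hinv.self_apply_inverse _)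

theorem mdifferentiableAt_mvfderiv_apply [IsManifold I 1 M]
    (hg : ContMDiff I 𝓘(𝕜, F) 2 g)
    (hV : MDifferentiableAt I I.tangent (fun x => (V x : TangentBundle I M)) x) :
    MDifferentiableAt I 𝓘(𝕜, F) (fun x => mvfderiv I g x (V x)) x := by
  have h := (hg.contMDiff_tangentMap (m := 1) (by norm_num)).mdifferentiable one_ne_zero
  have hsnd := (contMDiff_snd_tangentBundle_modelSpace F 𝓘(𝕜, F) (n := 1)).mdifferentiable
    one_ne_zero
  exact (hsnd _).comp x ((h _).comp x hV)

theorem fderivWithin_fderivWithin_comp_extChartAt_symm_apply_mpullbackWithin [IsManifold I 1 M]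
    (hg : ContMDiff I 𝓘(𝕜, F) 2 g)
    (hW : MDifferentiableAt I I.tangent (fun x => (W x : TangentBundle I M)) x) :
    fderivWithin 𝕜 (fun y => fderivWithin 𝕜 (g ∘ (extChartAt I x).symm) (range I) y
        (mpullbackWithin 𝓘(𝕜, E) I (extChartAt I x).symm W (range I) y)) (range I)
        (extChartAt I x x)
        (mpullbackWithin 𝓘(𝕜, E) I (extChartAt I x).symm V (range I) (extChartAt I x x)) =
      mvfderiv I (fun y => mvfderiv I g y (W y)) x (V x) := by
  have hWg : (fun y => fderivWithin 𝕜 (g ∘ (extChartAt I x).symm) (range I) y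
      (mpullbackWithin 𝓘(𝕜, E) I (extChartAt I x).symm W (range I) y))
      =ᶠ[𝓝[range I] extChartAt I x x] (fun y => mvfderiv I g y (W y)) ∘ (extChartAt I x).symm := by
    filter_upwards [extChartAt_target_mem_nhdsWithin x] with y hy
    exact fderivWithin_comp_extChartAt_symm_apply_mpullbackWithin hy
      (hg.mdifferentiable two_ne_zero _)
  have hx := extChartAt_to_inv (I := I) x
  rw [hWg.fderivWithin_eq (hWg.eq_of_nhdsWithin (mem_range_self _)),
    fderivWithin_comp_extChartAt_symm_apply_mpullbackWithin (mem_extChartAt_target x)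
      (hx.symm ▸ mdifferentiableAt_mvfderiv_apply hg hW)]
  exact congrArg (fun z => mvfderiv I (fun y => mvfderiv I g y (W y)) z (V z)) hx

theorem mlieBracket_eq_lieBracketWithin [IsManifold I 1 M] :
    mlieBracket I V W x =
      lieBracketWithin 𝕜 (mpullbackWithin 𝓘(𝕜, E) I (extChartAt I x).symm V (range I))
        (mpullbackWithin 𝓘(𝕜, E) I (extChartAt I x).symm W (range I)) (range I)
        (extChartAt I x x) := by
  have hid : (mfderiv I 𝓘(𝕜, E) (extChartAt I x) x).inverse = .id 𝕜 E := by
    rw [mfderiv_extChartAt_self]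
    exact ContinuousLinearMap.inverse_id
  rw [← mlieBracketWithin_univ, mlieBracketWithin_apply, hid, preimage_univ, univ_inter]
  rfl

theorem mvfderiv_mlieBracket [CompleteSpace E] [IsManifold I 2 M]
    (hg : ContMDiff I 𝓘(𝕜, F) (minSmoothness 𝕜 2) g)
    (hV : MDifferentiableAt I I.tangent (fun x => (V x : TangentBundle I M)) x)
    (hW : MDifferentiableAt I I.tangent (fun x => (W x : TangentBundle I M)) x) :
    mvfderiv I g x (mlieBracket I V W x) =
      mvfderiv I (fun y => mvfderiv I g y (W y)) x (V x) -
        mvfderiv I (fun y => mvfderiv I g y (V y)) x (W x) := by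
  have : IsManifold I 1 M := .of_le (n := 2) one_le_two
  have hg2 : ContMDiff I 𝓘(𝕜, F) 2 g := hg.of_le le_minSmoothness
  have hd {U : Π x : M, TangentSpace I x}
      (hU : MDifferentiableAt I I.tangent (fun x => (U x : TangentBundle I M)) x) :
      DifferentiableWithinAt 𝕜 (mpullbackWithin 𝓘(𝕜, E) I (extChartAt I x).symm U (range I))
        (range I) (extChartAt I x x) := by
    simpa only [preimage_univ, univ_inter] using
      (mdifferentiableWithinAt_univ.2 hU).differentiableWithinAt_mpullbackWithin_vectorField
  have hgx : ContDiffWithinAt 𝕜 (minSmoothness 𝕜 2) (g ∘ (extChartAt I x).symm) (range I)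
      (extChartAt I x x) := (contMDiffAt_iff.1 (hg x)).2
  rw [← fderivWithin_fderivWithin_comp_extChartAt_symm_apply_mpullbackWithin hg2 hV,
    ← fderivWithin_fderivWithin_comp_extChartAt_symm_apply_mpullbackWithin hg2 hW,
    ← fderivWithin_apply_lieBracket hgx le_rfl I.uniqueDiffOn
      (I.range_subset_closure_interior (mem_range_self _)) (mem_range_self _) (hd hW) (hd hV),
    mlieBracket_eq_lieBracketWithin]
  change mfderiv I 𝓘(𝕜, F) g x _ = _
  rw [(hg2.mdifferentiable two_ne_zero x).mfderiv]
  rfl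

theorem inTangentCoordinates_const_modelSpace [IsManifold I 1 M] {N : Type*} (p : M) (f : N → F)
    (ϕ : N → E →L[𝕜] F) (x : N) : inTangentCoordinates I 𝓘(𝕜, F) (fun _ => p) f ϕ x = ϕ := by
  ext y v
  rw [inTangentCoordinates_eq _ _ _ (mem_chart_source H p) (mem_univ _),
    ContinuousLinearMap.comp_apply, ContinuousLinearMap.comp_apply,
    (tangentBundleCore I M).coordChange_self _ _ (mem_chart_source H p)]
  exact (tangentBundleCore 𝓘(𝕜, F) F).coordChange_self (achart F (f x)) (f y) (mem_univ _) _

theorem contMDiff_mvfderiv_apply_of_uncurry [IsManifold I 1 M]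
    {E' : Type*} [NormedAddCommGroup E'] [NormedSpace 𝕜 E'] {H' : Type*} [TopologicalSpace H']
    {J : ModelWithCorners 𝕜 E' H'} {N : Type*} [TopologicalSpace N] [ChartedSpace H' N]
    [IsManifold J 1 N] {m k : ℕ∞ω} {f : N → M → F}
    (hf : ContMDiff (J.prod I) 𝓘(𝕜, F) k (Function.uncurry f)) (hk : m + 1 ≤ k) (p : M)
    (v : TangentSpace I p) : ContMDiff J 𝓘(𝕜, F) m fun x => mvfderiv I (f x) p v := by
  intro x
  have hv (w : E) : ContMDiffAt J 𝓘(𝕜, E) m (fun _ : N => w) x := contMDiffAt_const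
  have h := (hf (x, p)).mfderiv f (fun _ => p) contMDiffAt_const hk
  have heq := inTangentCoordinates_const_modelSpace (I := I) p (f · p)
    (fun y => mfderiv I 𝓘(𝕜, F) (f y) p) x
  exact (heq ▸ h).clm_apply (hv v)

end VectorField

section LieGroup

variable {𝕜 : Type*} [NontriviallyNormedField 𝕜]
  {E : Type*} [NormedAddCommGroup E] [NormedSpace 𝕜 E] {H : Type*} [TopologicalSpace H]
  {I : ModelWithCorners 𝕜 E H} {G : Type*} [TopologicalSpace G] [ChartedSpace H G] [Group G]
  {F : Type*} [NormedAddCommGroup F] [NormedSpace 𝕜 F] {k : ℕ∞ω}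
  [LieGroup I k G]

theorem mvfderiv_mulInvariantVectorField (hk : k ≠ 0) {g : G → F} {x : G}
    (hg : MDifferentiableAt I 𝓘(𝕜, F) g x) (v : GroupLieAlgebra I G) :
    mvfderiv I g x (mulInvariantVectorField v x) = mvfderiv I (fun y => g (x * y)) 1 v :=
  (mfderiv_comp_apply_of_eq (1 : G) hg
    ((contMDiff_mul_left (I := I) (n := k)).mdifferentiable hk 1) (mul_one x) v).symm

theorem contMDiff_mvfderiv_mulInvariantVectorField {m : ℕ∞ω} {g : G → F}
    (hg : ContMDiff I 𝓘(𝕜, F) k g) (hk : m + 1 ≤ k) (v : GroupLieAlgebra I G) :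
    ContMDiff I 𝓘(𝕜, F) m fun x => mvfderiv I g x (mulInvariantVectorField v x) := by
  have : IsManifold I k G := inferInstance
  have : IsManifold I 1 G := .of_le (n := k) (le_add_self.trans hk)
  have hk0 : k ≠ 0 := (zero_lt_one.trans_le (le_add_self.trans hk)).ne'
  simp_rw [mvfderiv_mulInvariantVectorField hk0 (hg.mdifferentiable hk0 _)]
  exact contMDiff_mvfderiv_apply_of_uncurry (hg.comp (contMDiff_mul I k)) hk 1 v

theorem mfderiv_mul_left_mulInvariantVectorField (hk : k ≠ 0) (v : GroupLieAlgebra I G) (x y : G) :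
    mfderiv I I (x * ·) y (mulInvariantVectorField v y) = mulInvariantVectorField v (x * y) := by
  have hd (a b : G) : MDifferentiableAt I I (a * ·) b :=
    (contMDiff_mul_left (I := I) (n := k)).mdifferentiable hk b
  have h := mfderiv_comp_apply_of_eq (1 : G) (hd x y) (hd y 1) (mul_one y) v
  have hc : (fun z : G => x * y * z) = (x * ·) ∘ (y * ·) := funext (mul_assoc x y)
  rw [mulInvariantVectorField, mulInvariantVectorField, hc]
  exact h.symm

end LieGroup

section OneParameterSubgroup

variable {E : Type*} [NormedAddCommGroup E] [NormedSpace ℝ E] {H : Type*} [TopologicalSpace H]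
  {I : ModelWithCorners ℝ E H} {G : Type*} [TopologicalSpace G] [ChartedSpace H G] [Group G]
  {F : Type*} [NormedAddCommGroup F] [NormedSpace ℝ F]
  {v : GroupLieAlgebra I G} {γ : ℝ → G}

/-- `γ` is the one-parameter subgroup `t ↦ exp (t v)` of the Lie group `G`: a homomorphism from `ℝ`
to `G` that is an integral curve of the left invariant vector field extending `v`. -/
structure IsOneParameterSubgroup (v : GroupLieAlgebra I G) (γ : ℝ → G) : Prop where
  isMIntegralCurve : IsMIntegralCurve γ (mulInvariantVectorField v)
  map_add : ∀ s t, γ (s + t) = γ s * γ t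

theorem IsOneParameterSubgroup.map_zero (hγ : IsOneParameterSubgroup v γ) : γ 0 = 1 := by
  simpa using hγ.map_add 0 0

theorem IsOneParameterSubgroup.commute (hγ : IsOneParameterSubgroup v γ) (s t : ℝ) :
    Commute (γ s) (γ t) := by
  rw [Commute, SemiconjBy, ← hγ.map_add, ← hγ.map_add, add_comm]

theorem isMIntegralCurveOn_mul_left {k : ℕ∞ω} [LieGroup I k G] (hk : k ≠ 0) {s : Set ℝ}
    (hγ : IsMIntegralCurveOn γ (mulInvariantVectorField v) s) (x : G) :
    IsMIntegralCurveOn (fun t => x * γ t) (mulInvariantVectorField (I := I) v) s := by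
  intro t ht
  have hd : MDifferentiableAt I I (x * ·) (γ t) :=
    (contMDiff_mul_left (I := I) (n := k)).mdifferentiable hk (γ t)
  refine (hd.hasMFDerivAt.comp_hasMFDerivWithinAt t (hγ t ht)).congr_mfderiv ?_
  rw [← mfderiv_mul_left_mulInvariantVectorField hk]
  ext
  exact map_smul (mfderiv I I (x * ·) (γ t)) _ _

theorem exists_isOneParameterSubgroup [LieGroup I (minSmoothness ℝ 3) G] [CompleteSpace E]
    [BoundarylessManifold I G] [T2Space G] (v : GroupLieAlgebra I G) :
    ∃ γ : ℝ → G, IsOneParameterSubgroup v γ := by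
  have hk : minSmoothness ℝ 3 ≠ 0 := by simp
  have : IsManifold I (minSmoothness ℝ 3) G := inferInstance
  have : IsManifold I 1 G := .of_le (n := minSmoothness ℝ 3) (by simp)
  have hv := (contMDiff_mulInvariantVectorField v).of_le (m := 1) (by simp)
  obtain ⟨γ₀, h0, hγ₀⟩ := exists_isMIntegralCurveAt_of_contMDiffAt_boundaryless (t₀ := 0)
    (hv.contMDiffAt (x := 1))
  obtain ⟨ε, hε, hγ₀⟩ := isMIntegralCurveAt_iff'.1 hγ₀
  rw [Real.ball_eq_Ioo, zero_sub, zero_add] at hγ₀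
  obtain ⟨γ, hγ0, hγ⟩ := exists_isMIntegralCurve_of_isMIntegralCurveOn hv hε
    (fun x => ⟨fun t => x * γ₀ t, by simp [h0], isMIntegralCurveOn_mul_left hk hγ₀ x⟩) 1
  refine ⟨γ, hγ, fun s t => ?_⟩
  have hmul : IsMIntegralCurve (fun t => γ s * γ t) (mulInvariantVectorField v) := by
    rw [isMIntegralCurve_iff_isMIntegralCurveOn] at hγ ⊢
    exact isMIntegralCurveOn_mul_left hk hγ _
  have heq := isMIntegralCurve_Ioo_eq_of_contMDiff_boundaryless (t₀ := 0) hv (hγ.comp_add s) hmul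
    (by simp [hγ0])
  simpa [add_comm] using congrFun heq t

variable {k : ℕ∞ω} [LieGroup I k G] {f : G → F} {x y : G}

theorem IsOneParameterSubgroup.hasDerivAt_comp_mul_left (hγ : IsOneParameterSubgroup v γ)
    (hk : k ≠ 0) {t : ℝ} (hy : x * γ t = y) (hf : MDifferentiableAt I 𝓘(ℝ, F) f y) :
    HasDerivAt (fun s => f (x * γ s)) (mvfderiv I f y (mulInvariantVectorField v y)) t := by
  subst hy
  have hx := isMIntegralCurveOn_mul_left hk (hγ.isMIntegralCurve.isMIntegralCurveOn Set.univ) x t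
    (Set.mem_univ t)
  have h := hf.hasMFDerivAt.comp t (hx.hasMFDerivAt Filter.univ_mem)
  refine hasDerivAt_iff_hasFDerivAt.2 (h.congr_mfderiv ?_).hasFDerivAt
  ext
  exact map_smul (mvfderiv I f (x * γ t)) _ _

theorem IsOneParameterSubgroup.mvfderiv_comp_mul_right (hγ : IsOneParameterSubgroup v γ)
    (hk : k ≠ 0) {s : ℝ} (hf : MDifferentiableAt I 𝓘(ℝ, F) f (x * γ s)) :
    mvfderiv I (fun y => f (y * γ s)) x (mulInvariantVectorField v x) =
      mvfderiv I f (x * γ s) (mulInvariantVectorField v (x * γ s)) := by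
  have hd := (contMDiff_mul_right (I := I) (n := k) (a := γ s)).mdifferentiable hk x
  have h0 (z : G) : z * γ 0 = z := by rw [hγ.map_zero, mul_one]
  have hleft := hγ.hasDerivAt_comp_mul_left hk (h0 x) (hf.comp x hd)
  have hright := hγ.hasDerivAt_comp_mul_left hk (h0 (x * γ s)) hf
  simp only [mul_assoc, (hγ.commute s _).eq] at hright
  simp only [Function.comp_apply, mul_assoc] at hleft
  exact hleft.unique hright

end OneParameterSubgroup

section Integral

variable {G : Type*} [TopologicalSpace G] [Group G] [IsTopologicalGroup G] [MeasurableSpace G]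
  [BorelSpace G] {F : Type*} [NormedAddCommGroup F] [NormedSpace ℝ F]

theorem hasDerivAt_integral_comp_mul_right (P : Measure G) [IsFiniteMeasureOnCompacts P]
    {f f' : G → F} (hf : Continuous f) (hfc : HasCompactSupport f) (hf' : Continuous f')
    (hfc' : HasCompactSupport f') {γ : ℝ → G} (hγ : Continuous γ)
    (hderiv : ∀ x t, HasDerivAt (fun t => f (x * γ t)) (f' (x * γ t)) t) (s : ℝ) :
    HasDerivAt (fun t => ∫ x, f (x * γ t) ∂P) (∫ x, f' (x * γ s) ∂P) s := by
  have hint {g : G → F} (hg : Continuous g) (hgc : HasCompactSupport g) (t : ℝ) :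
      Integrable (fun x => g (x * γ t)) P :=
    (hg.comp (continuous_mul_const _)).integrable_of_hasCompactSupport
      (hgc.comp_homeomorph (Homeomorph.mulRight (γ t)))
  obtain ⟨C, hC⟩ := hf'.bounded_above_of_compact_support hfc'
  -- Without a separation axiom a compact set need not be measurable, but its closure is.
  set K : Set G := closure (tsupport f' * (γ '' Metric.closedBall s 1)⁻¹)
  have hK : IsCompact K := (hfc'.isCompact.mul ((isCompact_closedBall s 1).image hγ).inv).closure
  have hbound (x : G) (t : ℝ) (ht : t ∈ Metric.closedBall s 1) :
      ‖f' (x * γ t)‖ ≤ K.indicator (fun _ => C) x := by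
    by_cases hx : x * γ t ∈ tsupport f'
    · have hxK : x ∈ K := subset_closure <| by
        simpa only [mul_inv_cancel_right] using
          Set.mul_mem_mul hx (Set.inv_mem_inv.2 (Set.mem_image_of_mem γ ht))
      simpa only [Set.indicator_of_mem hxK] using hC (x * γ t)
    · rw [image_eq_zero_of_notMem_tsupport hx, norm_zero]
      exact Set.indicator_nonneg (fun _ _ => (norm_nonneg _).trans (hC 1)) x
  exact (hasDerivAt_integral_of_dominated_loc_of_deriv_le (Metric.closedBall_mem_nhds s one_pos)
    (.of_forall fun t => (hint hf hfc t).aestronglyMeasurable) (hint hf hfc s)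
    (hint hf' hfc' s).aestronglyMeasurable (.of_forall hbound)
    ((integrable_indicator_iff isClosed_closure.measurableSet).2
      (integrableOn_const hK.measure_lt_top.ne))
    (.of_forall fun x t _ => hderiv x t)).2

end Integral

theorem eq_zero_of_forall_nonneg_add_mul {𝕜 : Type*} [Field 𝕜] [LinearOrder 𝕜]
    [IsStrictOrderedRing 𝕜] {a b : 𝕜} (h : ∀ s, 0 ≤ a + s * b) : b = 0 := by
  by_contra hb
  have hneg := h ((-1 - a) / b)
  rw [div_mul_cancel₀ _ hb] at hneg
  linarith

theorem eq_add_smul_of_hasDerivAt_of_hasDerivAt_zero {F : Type*} [NormedAddCommGroup F]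
    [NormedSpace ℝ F] {f f' : ℝ → F} (hf : ∀ s, HasDerivAt f (f' s) s)
    (hf' : ∀ s, HasDerivAt f' 0 s) (s : ℝ) :
    f s = f 0 + s • f' 0 := by
  have hconst (t : ℝ) : f' t = f' 0 :=
    is_const_of_deriv_eq_zero (fun t => (hf' t).differentiableAt) (fun t => (hf' t).deriv) t 0
  have hg (t : ℝ) : HasDerivAt (fun t => f t - t • f' 0) 0 t := by
    simpa only [hconst t, one_smul, sub_self] using
      (hf t).fun_sub ((hasDerivAt_id' t).smul_const (f' 0))
  have h := is_const_of_deriv_eq_zero (fun t => (hg t).differentiableAt) (fun t => (hg t).deriv) s 0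
  rwa [zero_smul, sub_zero, sub_eq_iff_eq_add] at h

section Bump

open Set
variable {E : Type*} [NormedAddCommGroup E] [NormedSpace ℝ E] [FiniteDimensional ℝ E]
  {H : Type*} [TopologicalSpace H] {I : ModelWithCorners ℝ E H} {M : Type*} [TopologicalSpace M]
  [ChartedSpace H M] [T2Space M] [IsManifold I ∞ M]

theorem exists_contMDiff_hasCompactSupport_one_le_of_isCompact {K : Set M} (hK : IsCompact K) :
    ∃ χ : M → ℝ, ContMDiff I 𝓘(ℝ) ∞ χ ∧ HasCompactSupport χ ∧ 0 ≤ χ ∧ ∀ x ∈ K, 1 ≤ χ x := by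
  refine hK.induction_on (p := fun K => ∃ χ : M → ℝ, ContMDiff I 𝓘(ℝ) ∞ χ ∧ HasCompactSupport χ ∧
    0 ≤ χ ∧ ∀ x ∈ K, 1 ≤ χ x) ?empty ?mono ?union ?nhds
  case empty => exact ⟨0, contMDiff_const, .zero, le_rfl, fun x hx => hx.elim⟩
  case mono =>
    rintro s t hst ⟨χ, hχ, hχc, hχ0, hχ1⟩
    exact ⟨χ, hχ, hχc, hχ0, fun x hx => hχ1 x (hst hx)⟩
  case union =>
    rintro s t ⟨χ, hχ, hχc, hχ0, hχ1⟩ ⟨η, hη, hηc, hη0, hη1⟩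
    refine ⟨χ + η, hχ.add hη, hχc.add hηc, add_nonneg hχ0 hη0, ?_⟩
    rintro x (hx | hx)
    · exact le_add_of_le_of_nonneg (hχ1 x hx) (hη0 x)
    · exact le_add_of_nonneg_of_le (hχ0 x) (hη1 x hx)
  case nhds =>
    intro x _
    obtain ⟨f⟩ : Nonempty (SmoothBumpFunction I x) := inferInstance
    exact ⟨{y | f y = 1}, mem_nhdsWithin_of_mem_nhds f.eventuallyEq_one, f, f.contMDiff,
      f.hasCompactSupport, fun _ => f.nonneg, fun _ hy => hy.ge⟩

end Bump

section LieAlgebra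

variable {R L : Type*} [CommRing R] [LieRing L] [LieAlgebra R L] {V : ℕ → Submodule R L}
  {A K : LieSubalgebra R L} {x y z : L}

theorem lie_mem_of_mem_span_singleton_sup (hz : z ∈ K.normalizer)
    (hx : x ∈ Submodule.span R {z} ⊔ K.toSubmodule)
    (hy : y ∈ Submodule.span R {z} ⊔ K.toSubmodule) : ⁅x, y⁆ ∈ K := by
  obtain ⟨_, ha, u, hu, rfl⟩ := Submodule.mem_sup.1 hx
  obtain ⟨_, hb, v, hv, rfl⟩ := Submodule.mem_sup.1 hy
  obtain ⟨a, rfl⟩ := Submodule.mem_span_singleton.1 ha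
  obtain ⟨b, rfl⟩ := Submodule.mem_span_singleton.1 hb
  have hzv : ⁅z, v⁆ ∈ K := (K.mem_normalizer_iff z).1 hz v hv
  have huz : ⁅u, z⁆ ∈ K := (K.mem_normalizer_iff' z).1 hz u hu
  have hexp : ⁅a • z + u, b • z + v⁆ = b • ⁅u, z⁆ + (a • ⁅z, v⁆ + ⁅u, v⁆) := by
    simp only [add_lie, lie_add, smul_lie, lie_smul, lie_self, smul_zero, zero_add]
  rw [hexp]
  exact add_mem (K.smul_mem b huz) (add_mem (K.smul_mem a hzv) (K.lie_mem hu hv))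

theorem layer_le_of_mem_normalizer
    (hV : ∀ i, 1 ≤ i → V (i + 1) ≤ Submodule.span R {z | ∃ x ∈ V 1, ∃ y ∈ V i, ⁅x, y⁆ = z})
    (hz : z ∈ K.normalizer) (hV₁ : V 1 ≤ Submodule.span R {z} ⊔ K.toSubmodule) {i : ℕ}
    (hi : 2 ≤ i) : V i ≤ K.toSubmodule := by
  have hsucc (j : ℕ) (hj : 1 ≤ j) (hVj : V j ≤ Submodule.span R {z} ⊔ K.toSubmodule) :
      V (j + 1) ≤ K.toSubmodule := by
    refine (hV j hj).trans (Submodule.span_le.2 ?_)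
    rintro _ ⟨x, hx, y, hy, rfl⟩
    exact lie_mem_of_mem_span_singleton_sup hz (hV₁ hx) (hVj hy)
  induction i, hi using Nat.le_induction with
  | base => exact hsucc 1 le_rfl hV₁
  | succ i hi ih => exact hsucc i (by lia) (ih.trans le_sup_right)

theorem mem_normalizer_lieSpan {s : Set L}
    (h : ∀ w ∈ s, ⁅z, w⁆ ∈ LieSubalgebra.lieSpan R L s) :
    z ∈ (LieSubalgebra.lieSpan R L s).normalizer := by
  refine (LieSubalgebra.mem_normalizer_iff _ z).2 fun x hx => ?_
  induction hx using LieSubalgebra.lieSpan_induction with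
  | mem y hy => exact h y hy
  | zero => rw [lie_zero]; exact zero_mem _
  | add x y _ _ hx hy => rw [lie_add]; exact add_mem hx hy
  | smul a x _ hx => rw [lie_smul]; exact SMulMemClass.smul_mem a hx
  | lie x y hx' hy' hx hy =>
    rw [leibniz_lie]
    exact add_mem (LieSubalgebra.lie_mem _ hx hy') (LieSubalgebra.lie_mem _ hx' hy)

theorem layer_le_of_lie_lie_eq_zero {ι : Type*} {Z : ι → L} {c : ι → R}
    (hV : ∀ i, 1 ≤ i → V (i + 1) ≤ Submodule.span R {z | ∃ x ∈ V 1, ∃ y ∈ V i, ⁅x, y⁆ = z})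
    (hV₁ : V 1 ≤ Submodule.span R (Set.range Z)) (hZ : ∀ i, ⁅z, ⁅z, Z i⁆⁆ = 0)
    (hA : ∀ i, Z i - c i • z ∈ A) (hzA : ∀ i, ⁅z, Z i⁆ ∈ A) {i : ℕ} (hi : 2 ≤ i) :
    V i ≤ A.toSubmodule := by
  set s : Set L := Set.range (fun i => Z i - c i • z) ∪ Set.range fun i => ⁅z, Z i⁆
  set K := LieSubalgebra.lieSpan R L s
  have hKA : K ≤ A := LieSubalgebra.lieSpan_le.2 <|
    Set.union_subset (Set.range_subset_iff.2 hA) (Set.range_subset_iff.2 hzA)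
  have hwK (i : ι) : Z i - c i • z ∈ K := LieSubalgebra.subset_lieSpan (.inl ⟨i, rfl⟩)
  have hzK (i : ι) : ⁅z, Z i⁆ ∈ K := LieSubalgebra.subset_lieSpan (.inr ⟨i, rfl⟩)
  have hz : z ∈ K.normalizer := by
    refine mem_normalizer_lieSpan ?_
    rintro _ (⟨i, rfl⟩ | ⟨i, rfl⟩)
    · simpa only [lie_sub, lie_smul, lie_self, smul_zero, sub_zero] using hzK i
    · simpa only [hZ i] using zero_mem K
  have hV₁K : V 1 ≤ Submodule.span R {z} ⊔ K.toSubmodule := by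
    refine hV₁.trans (Submodule.span_le.2 (Set.range_subset_iff.2 fun i => ?_))
    have hcz : c i • z ∈ Submodule.span R {z} :=
      Submodule.smul_mem _ _ (Submodule.mem_span_singleton_self z)
    exact Submodule.mem_sup.2 ⟨c i • z, hcz, Z i - c i • z, hwK i, add_sub_cancel _ _⟩
  exact (layer_le_of_mem_normalizer hV hz hV₁K hi).trans hKA

theorem lie_lie_sub_smul_eq_zero (hxy : ⁅x, ⁅x, y⁆⁆ = 0) (hyx : ⁅y, ⁅y, x⁆⁆ = 0) (c : R) :
    ⁅⁅x, y - c • x⁆, y - c • x⁆ = 0 := by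
  have hxyy : ⁅⁅x, y⁆, y⁆ = 0 := by
    rw [← lie_skew, ← lie_skew x y, lie_neg, hyx, neg_zero, neg_zero]
  have hxyx : ⁅⁅x, y⁆, x⁆ = 0 := by rw [← lie_skew, hxy, neg_zero]
  simp only [lie_sub, lie_smul, lie_self, smul_zero, sub_zero, hxyy, hxyx]

end LieAlgebra

namespace Carnot

variable {n : ℕ} {G : Type*} [TopologicalSpace G] [ChartedSpace (EuclideanSpace ℝ (Fin n)) G]

section LieDeriv

variable {φ : G → ℝ}

protected theorem IsTestFunction.continuous (hφ : IsTestFunction n φ) : Continuous φ :=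
  hφ.1.continuous

protected theorem IsTestFunction.mdifferentiable (hφ : IsTestFunction n φ) :
    MDifferentiable (𝓡 n) 𝓘(ℝ, ℝ) φ :=
  hφ.1.mdifferentiable (by simp)

protected theorem IsTestFunction.integrable [MeasurableSpace G] [OpensMeasurableSpace G]
    (hφ : IsTestFunction n φ) (P : Measure G) [IsFiniteMeasureOnCompacts P] : Integrable φ P :=
  hφ.continuous.integrable_of_hasCompactSupport hφ.2

protected theorem IsTestFunction.sub {ψ : G → ℝ} (hφ : IsTestFunction n φ)
    (hψ : IsTestFunction n ψ) : IsTestFunction n (φ - ψ) :=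
  ⟨hφ.1.sub hψ.1, hφ.2.sub hψ.2⟩

theorem IsTestFunction.exists_abs_le [T2Space G] [IsManifold (𝓡 n) ∞ G]
    (hφ : IsTestFunction n φ) : ∃ χ : G → ℝ, IsTestFunction n χ ∧ ∀ x, |φ x| ≤ χ x := by
  obtain ⟨C, hC⟩ := hφ.continuous.bounded_above_of_compact_support hφ.2
  obtain ⟨χ, hχ, hχc, hχ0, hχ1⟩ :=
    exists_contMDiff_hasCompactSupport_one_le_of_isCompact (I := 𝓡 n) hφ.2.isCompact
  refine ⟨fun x => C * χ x, ⟨contMDiff_const.mul hχ, hχc.mul_left⟩, fun x => ?_⟩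
  have hC0 : 0 ≤ C := (norm_nonneg _).trans (hC x)
  by_cases hx : x ∈ tsupport φ
  · exact (hC x).trans (le_mul_of_one_le_right hC0 (hχ1 x hx))
  · rw [image_eq_zero_of_notMem_tsupport hx, abs_zero]
    exact mul_nonneg hC0 (hχ0 x)

variable [Group G]

theorem lieDeriv_add (X Y : GroupLieAlgebra (𝓡 n) G) (φ : G → ℝ) :
    lieDeriv (X + Y) φ = lieDeriv X φ + lieDeriv Y φ := by
  ext x
  rw [lieDeriv, mulInvariantVectorField_add]
  exact map_add (mfderiv (𝓡 n) 𝓘(ℝ, ℝ) φ x) _ _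

theorem lieDeriv_smul (c : ℝ) (X : GroupLieAlgebra (𝓡 n) G) (φ : G → ℝ) :
    lieDeriv (c • X) φ = c • lieDeriv X φ := by
  ext x
  rw [lieDeriv, mulInvariantVectorField_smul]
  exact map_smul (mfderiv (𝓡 n) 𝓘(ℝ, ℝ) φ x) _ _

theorem lieDeriv_sub (X : GroupLieAlgebra (𝓡 n) G) {ψ : G → ℝ} (hφ : IsTestFunction n φ)
    (hψ : IsTestFunction n ψ) : lieDeriv X (φ - ψ) = lieDeriv X φ - lieDeriv X ψ := by
  ext x
  rw [lieDeriv, mfderiv_sub (hφ.mdifferentiable x) (hψ.mdifferentiable x)]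
  rfl

theorem support_lieDeriv_subset (X : GroupLieAlgebra (𝓡 n) G) (φ : G → ℝ) :
    Function.support (lieDeriv X φ) ⊆ tsupport φ := by
  intro x hx
  by_contra h
  have hzero : mfderiv (𝓡 n) 𝓘(ℝ, ℝ) φ x = mfderiv (𝓡 n) 𝓘(ℝ, ℝ) (fun _ : G => (0 : ℝ)) x :=
    (notMem_tsupport_iff_eventuallyEq.1 h).mfderiv_eq
  refine hx ?_
  rw [lieDeriv, hzero, mfderiv_const]
  rfl

variable [LieGroup (𝓡 n) ∞ G]

protected theorem IsTestFunction.lieDeriv (hφ : IsTestFunction n φ) (X : GroupLieAlgebra (𝓡 n) G) :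
    IsTestFunction n (lieDeriv X φ) :=
  ⟨contMDiff_mvfderiv_mulInvariantVectorField hφ.1 (by simp) X,
    hφ.2.mono' (support_lieDeriv_subset X φ)⟩

protected theorem IsTestFunction.comp_mul_right (hφ : IsTestFunction n φ) (g : G) :
    IsTestFunction n (fun x => φ (x * g)) := by
  have : IsTopologicalGroup G := topologicalGroup_of_lieGroup (𝓡 n) ∞
  exact ⟨hφ.1.comp (contMDiff_mul_right (I := 𝓡 n)), hφ.2.comp_homeomorph (Homeomorph.mulRight g)⟩

instance lieGroup_minSmoothness : LieGroup (𝓡 n) (minSmoothness ℝ 3) G :=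
  .of_le (n := ∞) (by rw [minSmoothness_of_isRCLikeNormedField]; exact ENat.LEInfty.out)

theorem lieDeriv_lie (X Y : GroupLieAlgebra (𝓡 n) G) (hφ : IsTestFunction n φ) :
    lieDeriv ⁅X, Y⁆ φ = lieDeriv X (lieDeriv Y φ) - lieDeriv Y (lieDeriv X φ) := by
  have : IsManifold (𝓡 n) 2 G := .of_le (n := ∞) ENat.LEInfty.out
  have hle : minSmoothness ℝ 2 ≤ (∞ : ℕ∞ω) := by
    rw [minSmoothness_of_isRCLikeNormedField]; exact ENat.LEInfty.out
  ext x
  refine .trans ?_ (mvfderiv_mlieBracket (hφ.1.of_le hle)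
    (mdifferentiable_mulInvariantVectorField X x) (mdifferentiable_mulInvariantVectorField Y x))
  rw [← mulInvariantVector_mlieBracket]
  rfl

theorem lieDeriv_comp_mul_right {W : GroupLieAlgebra (𝓡 n) G} {γ : ℝ → G}
    (hγ : IsOneParameterSubgroup W γ) (hφ : IsTestFunction n φ) (s : ℝ) :
    lieDeriv W (fun x => φ (x * γ s)) = fun x => lieDeriv W φ (x * γ s) :=
  funext fun x => hγ.mvfderiv_comp_mul_right (k := ∞) (by simp) (hφ.mdifferentiable (x * γ s))

end LieDeriv

variable [Group G] [MeasurableSpace G]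

theorem indicatorDeriv_smul {μ : Measure G} {E : Set G} (c : ℝ) (X : GroupLieAlgebra (𝓡 n) G)
    (φ : G → ℝ) :
    indicatorDeriv μ E (c • X) φ = c * indicatorDeriv μ E X φ := by
  simp only [indicatorDeriv, lieDeriv_smul, Pi.smul_apply, smul_eq_mul]
  rw [integral_const_mul, mul_neg]

variable [LieGroup (𝓡 n) ∞ G] [BorelSpace G]

section Positivity

variable {P : Measure G} [IsFiniteMeasureOnCompacts P] {W : GroupLieAlgebra (𝓡 n) G}
  {φ : G → ℝ}

protected theorem IsTestFunction.hasDerivAt_integral_comp_mul_right (hφ : IsTestFunction n φ)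
    {γ : ℝ → G} (hγ : IsOneParameterSubgroup W γ) (s : ℝ) :
    HasDerivAt (fun t => ∫ x, φ (x * γ t) ∂P) (∫ x, lieDeriv W φ (x * γ s) ∂P) s := by
  have : IsTopologicalGroup G := topologicalGroup_of_lieGroup (𝓡 n) ∞
  exact hasDerivAt_integral_comp_mul_right P hφ.continuous hφ.2 (hφ.lieDeriv W).continuous
    (hφ.lieDeriv W).2 hγ.isMIntegralCurve.continuous
    (fun x t => hγ.hasDerivAt_comp_mul_left (k := ∞) (by simp) rfl (hφ.mdifferentiable _)) s

theorem integral_comp_mul_right_eq_add_mul {γ : ℝ → G} (hγ : IsOneParameterSubgroup W γ)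
    (hW : ∀ ψ : G → ℝ, IsTestFunction n ψ → ∫ x, lieDeriv W (lieDeriv W ψ) x ∂P = 0)
    (hφ : IsTestFunction n φ) (s : ℝ) :
    ∫ x, φ (x * γ s) ∂P = ∫ x, φ x ∂P + s * ∫ x, lieDeriv W φ x ∂P := by
  have hsecond (t : ℝ) : HasDerivAt (fun t => ∫ x, lieDeriv W φ (x * γ t) ∂P) 0 t := by
    have h := (hφ.lieDeriv W).hasDerivAt_integral_comp_mul_right (P := P) hγ t
    rwa [← lieDeriv_comp_mul_right hγ (hφ.lieDeriv W), ← lieDeriv_comp_mul_right hγ hφ,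
      hW _ (hφ.comp_mul_right (γ t))] at h
  simpa only [hγ.map_zero, mul_one, smul_eq_mul] using eq_add_smul_of_hasDerivAt_of_hasDerivAt_zero
    (hφ.hasDerivAt_integral_comp_mul_right hγ) hsecond s

theorem integral_lieDeriv_eq_zero_of_nonneg [T2Space G]
    (hW : ∀ ψ : G → ℝ, IsTestFunction n ψ → ∫ x, lieDeriv W (lieDeriv W ψ) x ∂P = 0)
    (hφ : IsTestFunction n φ) (h0 : 0 ≤ φ) : ∫ x, lieDeriv W φ x ∂P = 0 := by
  obtain ⟨γ, hγ⟩ := exists_isOneParameterSubgroup W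
  refine eq_zero_of_forall_nonneg_add_mul (a := ∫ x, φ x ∂P) fun s => ?_
  rw [← integral_comp_mul_right_eq_add_mul hγ hW hφ s]
  exact integral_nonneg fun x => h0 (x * γ s)

theorem integral_lieDeriv_eq_zero [T2Space G]
    (hW : ∀ ψ : G → ℝ, IsTestFunction n ψ → ∫ x, lieDeriv W (lieDeriv W ψ) x ∂P = 0)
    (hφ : IsTestFunction n φ) : ∫ x, lieDeriv W φ x ∂P = 0 := by
  obtain ⟨χ, hχ, hle⟩ := hφ.exists_abs_le
  have hχW := integral_lieDeriv_eq_zero_of_nonneg hW hχ fun x => (abs_nonneg _).trans (hle x)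
  have hsub := integral_lieDeriv_eq_zero_of_nonneg hW (hχ.sub hφ) fun x =>
    sub_nonneg.2 (le_of_abs_le (hle x))
  rw [lieDeriv_sub W hχ hφ] at hsub
  simp only [Pi.sub_apply] at hsub
  rwa [integral_sub ((hχ.lieDeriv W).integrable P) ((hφ.lieDeriv W).integrable P), hχW, zero_sub,
    neg_eq_zero] at hsub

end Positivity

section IndicatorDeriv

variable {μ : Measure G} [IsFiniteMeasureOnCompacts μ] {E : Set G} {φ : G → ℝ}

theorem indicatorDeriv_add (X Y : GroupLieAlgebra (𝓡 n) G) (hφ : IsTestFunction n φ) :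
    indicatorDeriv μ E (X + Y) φ = indicatorDeriv μ E X φ + indicatorDeriv μ E Y φ := by
  simp only [indicatorDeriv, lieDeriv_add, Pi.add_apply]
  rw [integral_add ((hφ.lieDeriv X).integrable _) ((hφ.lieDeriv Y).integrable _), neg_add]

theorem indicatorDeriv_lie (X Y : GroupLieAlgebra (𝓡 n) G) (hφ : IsTestFunction n φ) :
    indicatorDeriv μ E ⁅X, Y⁆ φ =
      indicatorDeriv μ E X (lieDeriv Y φ) - indicatorDeriv μ E Y (lieDeriv X φ) := by
  simp only [indicatorDeriv, lieDeriv_lie X Y hφ, Pi.sub_apply]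
  rw [integral_sub (((hφ.lieDeriv Y).lieDeriv X).integrable _)
    (((hφ.lieDeriv X).lieDeriv Y).integrable _), neg_sub_neg, neg_sub]

variable (n μ E) in
/-- The Lie algebra of the left invariant vector fields `Y` with `Y 𝟙_E = 0` as a distribution. In
these terms, a vertical halfspace is a set whose annihilator contains the layers `2, …, κ`. -/
def indicatorAnnihilator : LieSubalgebra ℝ (GroupLieAlgebra (𝓡 n) G) where
  carrier := {Y | IndicatorDerivEqZero μ E Y}
  add_mem' {X Y} hX hY φ hφ := by rw [indicatorDeriv_add X Y hφ, hX φ hφ, hY φ hφ, add_zero]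
  zero_mem' φ _ := by
    rw [← zero_smul ℝ (0 : GroupLieAlgebra (𝓡 n) G), indicatorDeriv_smul, zero_mul]
  smul_mem' c X hX φ hφ := by rw [indicatorDeriv_smul, hX φ hφ, mul_zero]
  lie_mem' {X Y} hX hY φ hφ := by
    rw [indicatorDeriv_lie X Y hφ, hX _ (hφ.lieDeriv Y), hY _ (hφ.lieDeriv X), sub_zero]

theorem indicatorDerivEqZero_lie_of_lie_lie_eq_zero [T2Space G] {P : Measure G}
    [IsFiniteMeasureOnCompacts P] {Z W : GroupLieAlgebra (𝓡 n) G} {c : ℝ} (hc : c ≠ 0)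
    (hZ : ∀ φ : G → ℝ, IsTestFunction n φ → indicatorDeriv μ E Z φ = c * ∫ x, φ x ∂P)
    (hW : IndicatorDerivEqZero μ E W) (hZW : ⁅⁅Z, W⁆, W⁆ = 0) :
    IndicatorDerivEqZero μ E ⁅Z, W⁆ := by
  have hbracket (ψ : G → ℝ) (hψ : IsTestFunction n ψ) :
      indicatorDeriv μ E ⁅Z, W⁆ ψ = c * ∫ x, lieDeriv W ψ x ∂P := by
    rw [indicatorDeriv_lie Z W hψ, hW _ (hψ.lieDeriv Z), hZ _ (hψ.lieDeriv W), sub_zero]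
  have hsecond (ψ : G → ℝ) (hψ : IsTestFunction n ψ) :
      ∫ x, lieDeriv W (lieDeriv W ψ) x ∂P = 0 := by
    have h := (indicatorAnnihilator n μ E).zero_mem ψ hψ
    rw [← hZW, indicatorDeriv_lie _ _ hψ, hW _ (hψ.lieDeriv _), sub_zero,
      hbracket _ (hψ.lieDeriv W)] at h
    exact (mul_eq_zero.1 h).resolve_left hc
  intro φ hφ
  rw [hbracket φ hφ, integral_lieDeriv_eq_zero hsecond hφ, mul_zero]

variable {m : ℕ} {V : ℕ → Submodule ℝ (GroupLieAlgebra (𝓡 n) G)}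
  {B : Module.Basis (Fin m) ℝ (V 1)}

theorem HasConstantIntrinsicNormal.exists_linearMap (hE : HasConstantIntrinsicNormal μ V B E) :
    ∃ (P : Measure G) (l : V 1 →ₗ[ℝ] ℝ), IsLocallyFiniteMeasure P ∧ l ≠ 0 ∧
      ∀ (Y : V 1) (φ : G → ℝ), IsTestFunction n φ →
        indicatorDeriv μ E (Y : GroupLieAlgebra (𝓡 n) G) φ = l Y * ∫ x, φ x ∂P := by
  obtain ⟨-, P, ν, hP, hP0, ⟨-, hν1, hν⟩, v, hv⟩ := hE
  refine ⟨P, B.constr ℝ fun i => v i, hP.1, fun hl => ?_, fun Y φ hφ => ?_⟩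
  · have : (ae P).NeBot := ae_neBot.2 hP0
    obtain ⟨x, hx1, hx⟩ := (hν1.and hv).exists
    have hv0 : v = 0 := by
      ext i
      simpa using LinearMap.congr_fun hl (B i)
    simp [hx, hv0] at hx1
  · let T : V 1 →ₗ[ℝ] ℝ :=
      { toFun := fun Y => indicatorDeriv μ E (Y : GroupLieAlgebra (𝓡 n) G) φ
        map_add' := fun Y Y' => indicatorDeriv_add _ _ hφ
        map_smul' := fun c Y => indicatorDeriv_smul c _ φ }
    have hT : T = (∫ x, φ x ∂P) • B.constr ℝ fun i => v i := B.ext fun i =>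
      calc indicatorDeriv μ E (B i : GroupLieAlgebra (𝓡 n) G) φ
        _ = ∫ x, φ x * ν x i ∂P := hν i φ hφ
        _ = ∫ x, φ x * v i ∂P := integral_congr_ae (hv.mono fun x hx => by simp only [hx])
        _ = ((∫ x, φ x ∂P) • B.constr ℝ fun i => v i) (B i) := by
          rw [integral_mul_const, LinearMap.smul_apply, B.constr_basis, smul_eq_mul]
    exact (LinearMap.congr_fun hT Y).trans (mul_comm _ _)

theorem layer_le_indicatorAnnihilator [T2Space G] {P : Measure G} [IsFiniteMeasureOnCompacts P]
    (hV : ∀ i, 1 ≤ i → V (i + 1) ≤ Submodule.span ℝ {Z | ∃ X ∈ V 1, ∃ Y ∈ V i, ⁅X, Y⁆ = Z})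
    (hstar : IsTypeStar V) {l : V 1 →ₗ[ℝ] ℝ} (hl : l ≠ 0)
    (hlP : ∀ (Y : V 1) (φ : G → ℝ), IsTestFunction n φ →
      indicatorDeriv μ E (Y : GroupLieAlgebra (𝓡 n) G) φ = l Y * ∫ x, φ x ∂P) {i : ℕ}
    (hi : 2 ≤ i) : V i ≤ (indicatorAnnihilator n μ E).toSubmodule := by
  obtain ⟨d, Z, hZ⟩ := hstar
  obtain ⟨k, hk⟩ : ∃ k, l (Z k) ≠ 0 := by
    by_contra! h
    exact hl (Z.ext h)
  set c : Fin d → ℝ := fun i => l (Z i) / l (Z k)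
  have hspan : Submodule.span ℝ (Set.range fun i => (Z i : GroupLieAlgebra (𝓡 n) G)) = V 1 := by
    have hmap := Submodule.map_span (V 1).subtype (Set.range Z)
    rw [Z.span_eq, Submodule.map_subtype_top, ← Set.range_comp] at hmap
    exact hmap.symm
  have hw (i : Fin d) : (Z i - c i • Z k : GroupLieAlgebra (𝓡 n) G) ∈
      indicatorAnnihilator n μ E := fun φ hφ => by
    have hker : l (Z i - c i • Z k) = 0 := by
      rw [map_sub, map_smul, smul_eq_mul, div_mul_cancel₀ _ hk, sub_self]
    rw [← Submodule.coe_smul, ← Submodule.coe_sub, hlP _ φ hφ, hker, zero_mul]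
  have hzw (i : Fin d) : ⁅(Z k : GroupLieAlgebra (𝓡 n) G), (Z i : GroupLieAlgebra (𝓡 n) G)⁆ ∈
      indicatorAnnihilator n μ E := by
    have h := indicatorDerivEqZero_lie_of_lie_lie_eq_zero hk (hlP (Z k)) (hw i)
      (lie_lie_sub_smul_eq_zero (hZ i k) (hZ k i) (c i))
    rwa [lie_sub, lie_smul, lie_self, smul_zero, sub_zero] at h
  exact layer_le_of_lie_lie_eq_zero hV hspan.ge (fun i => hZ i k) hw hzw hi

end IndicatorDeriv

end Carnot

theorem theorem3p7_general {n : ℕ} {G : Type*} [TopologicalSpace G] [T2Space G]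
    [ChartedSpace (EuclideanSpace ℝ (Fin n)) G] [Group G] [LieGroup (𝓡 n) ∞ G]
    [MeasurableSpace G] [BorelSpace G] (μ : Measure G) [IsFiniteMeasureOnCompacts μ]
    (κ : ℕ) {V : ℕ → Submodule ℝ (GroupLieAlgebra (𝓡 n) G)}
    (hV : ∀ i, 1 ≤ i → V (i + 1) ≤ Submodule.span ℝ {Z | ∃ X ∈ V 1, ∃ Y ∈ V i, ⁅X, Y⁆ = Z})
    (hstar : Carnot.IsTypeStar V) {m : ℕ} (X : Module.Basis (Fin m) ℝ (V 1))
    (E : Set G) (hE : Carnot.HasConstantIntrinsicNormal μ V X E) :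
    Carnot.IsVerticalHalfspace μ κ V X E := by
  obtain ⟨P, l, hP, hl, hlP⟩ := hE.exists_linearMap
  have hle : ⨆ i ∈ Set.Icc 2 κ, V i ≤ (Carnot.indicatorAnnihilator n μ E).toSubmodule :=
    iSup₂_le fun i hi => Carnot.layer_le_indicatorAnnihilator hV hstar hl hlP hi.1
  exact ⟨hE, fun Y hY => hle hY⟩

theorem theorem3p7 {n : ℕ} {G : Type*} [TopologicalSpace G] [T2Space G]
    [SecondCountableTopology G] [ChartedSpace (EuclideanSpace ℝ (Fin n)) G] [Group G]
    [LieGroup (𝓡 n) ∞ G] [MeasurableSpace G] [BorelSpace G]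
    (μ : Measure G) [μ.IsHaarMeasure]
    (κ : ℕ) (V : ℕ → Submodule ℝ (GroupLieAlgebra (𝓡 n) G))
    (hG : Carnot.IsCarnotGroup κ V) (hstar : Carnot.IsTypeStar V)
    {m : ℕ} (X : Module.Basis (Fin m) ℝ (V 1))
    (E : Set G) (hE : Carnot.HasConstantIntrinsicNormal μ V X E) :
    Carnot.IsVerticalHalfspace μ κ V X E := by
  exact theorem3p7_general μ κ (fun i hi => (hG.isStratification.bracket_eq i hi).ge) hstar X E hE
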